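/- Let $(X,Y)$ be a dual pair of real locally convex spaces with separating bilinear form $\langle\cdot,\cdot\rangle$, whose topologies are compatible with the pairing (the continuous dual of $X$ is $Y$ and that of $Y$ is $X$). Let $\Phi:X\to\mathbb{R}\cup\{+\infty\}$ be proper, convex and lower semicontinuous, $\bar x\in\operatorname{dom}\Phi=\{x\mid\Phi(x)<+\infty\}$ and $\lambda\in\mathbb{R}$. Write $[\Phi\le a]=\{x\in X\mid \Phi(x)\le a\}$; $S_\infty=\{v\in X\mid x+tv\in S\ \ \forall x\in S,\ t\ge 0\}$ for the asymptotic (recession) cone of a nonempty closed convex set $S\subset X$; $\mathrm{N}_S(\bar x)=\{x^*\in Y\mid\langle x^*,x-\bar x\rangle\le 0\ \ \forall x\in S\}$; $\partial_\varepsilon\Phi(\bar x)=\{x^*\in Y\mid \langle x^*,u-\bar x\rangle\le\Phi(u)-\Phi(\bar x)+\varepsilon\ \ \forall u\in X\}$ for $\varepsilon\ge0$ and $\partial_\varepsilon\Phi(\bar x)=\emptyset$ for $\varepsilon<0$; $\mathbb{R}_+A=\{ta\mid t\ge0,\ a\in A\}$; and $\operatorname{cl}$ for the closure in $Y$. (1)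 If $[\Phi\le\lambda]\ne\emptyset$ and $\Phi(\bar x)>\lambda$, then $$\mathrm{N}_{[\Phi\le\lambda]\cup(\bar x+[\Phi\le\Phi(\bar x)]_\infty)}(\bar x)=\operatorname{cl}\bigl(\mathbb{R}_+\,\partial_{\Phi(\bar x)-\lambda}\Phi(\bar x)\bigr).$$ (2) If $[\Phi\le\lambda]=\emptyset$, then $$\mathrm{N}_{\bar x+[\Phi\le\Phi(\bar x)]_\infty}(\bar x)=\limsup_{\substack{\mu(\lambda-\Phi(\bar x)+\varepsilon)\to0\\ \mu\ge0}}\mu\,\partial_\varepsilon\Phi(\bar x)=\operatorname{cl}\bigl(\mathbb{R}_+\,\partial_\varepsilon\Phi(\bar x)\bigr),$$ where the last equality holds for every real $\varepsilon\ge\Phi(\bar x)-\lambda$, and the $\limsup$ is the set of all $\xi\in Y$ such that for every neighbourhood $W$ of $\xi$ and every $\eta>0$ there are $\mu\ge0$ and $\varepsilon\in\mathbb{R}$ with $|\mu(\lambda-\Phi(\bar x)+\varepsilon)|<\eta$ and $\mu\,\partial_\varepsilon\Phi(\bar x)\cap W\neq\emptyset$. -/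

import Mathlib

open scoped Pointwise Topology

/-- A separating bilinear form `B : X × Y → ℝ`, with topologies on `X` and `Y` compatible with it:
the continuous linear functionals on `X` are exactly the functionals `x ↦ B x y` with `y : Y`, and
the continuous linear functionals on `Y` are exactly the functionals `y ↦ B x y` with `x : X`. -/
structure IsCompatibleDualPair {X Y : Type*}
    [AddCommGroup X] [Module ℝ X] [TopologicalSpace X]
    [AddCommGroup Y] [Module ℝ Y] [TopologicalSpace Y]
    (B : X →ₗ[ℝ] Y →ₗ[ℝ] ℝ) : Prop where
  separatingLeft : B.SeparatingLeft
  separatingRight : B.SeparatingRight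
  continuous_iff_left : ∀ f : X →ₗ[ℝ] ℝ, Continuous f ↔ ∃ y : Y, ∀ x : X, f x = B x y
  continuous_iff_right : ∀ g : Y →ₗ[ℝ] ℝ, Continuous g ↔ ∃ x : X, ∀ y : Y, g y = B x y

/-- The effective domain `dom Φ`. -/
def effectiveDomain {X : Type*} (Φ : X → EReal) : Set X := {x | Φ x < ⊤}

/-- The class `Γ₀(X)` of proper, convex, lower semicontinuous functions `Φ : X → ℝ ∪ {+∞}`.
Convexity is convexity of the epigraph. -/
structure IsGammaZero {X : Type*} [AddCommGroup X] [Module ℝ X] [TopologicalSpace X]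
    (Φ : X → EReal) : Prop where
  ne_bot : ∀ x, Φ x ≠ ⊥
  proper : (effectiveDomain Φ).Nonempty
  convex : Convex ℝ {p : X × ℝ | Φ p.1 ≤ (p.2 : EReal)}
  lsc : LowerSemicontinuous Φ

/-- The sublevel set `[Φ ≤ a]`. -/
def sublevelSet {X : Type*} (Φ : X → EReal) (a : EReal) : Set X := {x | Φ x ≤ a}

/-- The asymptotic (recession) cone `S_∞` of a nonempty closed convex set `S`: the directions `v`
with `x + t v ∈ S` for all `x ∈ S` and `t ≥ 0`. Its indicator function is the asymptotic function
`v ↦ sup_{t > 0} t⁻¹ (I_S (x + t v) - I_S x)`, `x ∈ S`, of the indicator function `I_S` of `S`. -/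
def asymptoticConeOf {X : Type*} [AddCommGroup X] [Module ℝ X] (S : Set X) : Set X :=
  {v | ∀ x ∈ S, ∀ t : ℝ, 0 ≤ t → x + t • v ∈ S}

/-- The normal cone `N_S(x̄) = {y ∈ Y | ⟨y, x - x̄⟩ ≤ 0 for all x ∈ S}`. -/
def normalCone {X Y : Type*} [AddCommGroup X] [Module ℝ X] [AddCommGroup Y] [Module ℝ Y]
    (B : X →ₗ[ℝ] Y →ₗ[ℝ] ℝ) (S : Set X) (xbar : X) : Set Y :=
  {y | ∀ x ∈ S, B (x - xbar) y ≤ 0}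

/-- The `ε`-subdifferential `∂_ε Φ(x)`; it is empty if `ε < 0` or `x ∉ dom Φ`. -/
def epsSubdifferential {X Y : Type*}
    [AddCommGroup X] [Module ℝ X] [AddCommGroup Y] [Module ℝ Y]
    (B : X →ₗ[ℝ] Y →ₗ[ℝ] ℝ) (Φ : X → EReal) (ε : ℝ) (x : X) : Set Y :=
  {y | 0 ≤ ε ∧ x ∈ effectiveDomain Φ ∧
    ∀ u : X, ((B (u - x) y : ℝ) : EReal) ≤ Φ u - Φ x + (ε : EReal)}

/-- The Painlevé–Kuratowski upper limit of the sets `M u` along the filter `l`: the points `v` such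
that for every neighbourhood `W` of `v` and every `Z ∈ l` some `u ∈ Z` has `M u ∩ W ≠ ∅`. -/
def kuratowskiLimsup {U V : Type*} [TopologicalSpace V] (l : Filter U) (M : U → Set V) : Set V :=
  {v | ∀ W ∈ 𝓝 v, ∀ Z ∈ l, ∃ u ∈ Z, (M u ∩ W).Nonempty}

/-! Write `c = Φ x` and look at the epigraph from the point `(x, lam)`, with `lam < c`. A vector `y`
is a `(c - lam)`-subgradient exactly when `(y, -1)` is nonpositive on the cone `K` generated by the
epigraph from there. The nontrivial inclusion is a bipolar argument. A normal vector `y` outside the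
closed cone of subgradients is separated from it by some `v` in `X`: every subgradient is
nonpositive at `v`, while `B v y > 0`. If `(v, 0)` lies outside `closure K`, then
`exists_mem_epsSubdifferential_pos` gives a subgradient positive at `v`. If it lies inside, then
`exists_le_or_mem_asymptoticConeOf` shows that `v` points into `[Φ ≤ lam]` or is asymptotic, so
normality forces `B v y ≤ 0`. Both cases are absurd.

When `[Φ ≤ lam]` is empty, so is every lower sublevel set, and the same identity holds for all
larger `ε`. The upper limit is squeezed between the closed cone for `ε = c - lam` and the normal
cone. -/

section EpigraphAndSubdifferential

variable {X Y : Type*}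
  [AddCommGroup X] [Module ℝ X] [AddCommGroup Y] [Module ℝ Y]

/-- The epigraph of an extended-real-valued function, as a subset of `X × ℝ`. -/
def realEpigraph (Φ : X → EReal) : Set (X × ℝ) := {p | Φ p.1 ≤ (p.2 : EReal)}

theorem mem_epsSubdifferential_iff {B : X →ₗ[ℝ] Y →ₗ[ℝ] ℝ} {Φ : X → EReal}
    (hbot : ∀ u, Φ u ≠ ⊥) {x : X} {c : ℝ} (hc : Φ x = c) {ε : ℝ} {y : Y} :
    y ∈ epsSubdifferential B Φ ε x ↔
      0 ≤ ε ∧ ∀ p ∈ realEpigraph Φ, B (p.1 - x) y ≤ p.2 - c + ε := by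
  have hdom : x ∈ effectiveDomain Φ := by
    change Φ x < ⊤
    rw [hc]
    exact EReal.coe_lt_top c
  constructor
  · rintro ⟨h0, -, h⟩
    refine ⟨h0, fun p hp => ?_⟩
    have hp' : Φ p.1 ≤ (p.2 : EReal) := hp
    have h1 := h p.1
    rw [hc] at h1
    have h2 : ((B (p.1 - x) y : ℝ) : EReal) ≤ (p.2 : EReal) - c + ε :=
      h1.trans (add_le_add (EReal.sub_le_sub hp' le_rfl) le_rfl)
    exact_mod_cast h2
  · rintro ⟨h0, h⟩
    refine ⟨h0, hdom, fun u => ?_⟩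
    rw [hc]
    induction hu : Φ u with
    | bot => exact absurd hu (hbot u)
    | top => simp
    | coe r =>
      have := h (u, r) hu.le
      exact_mod_cast this

theorem convex_epsSubdifferential {B : X →ₗ[ℝ] Y →ₗ[ℝ] ℝ} {Φ : X → EReal}
    (hbot : ∀ u, Φ u ≠ ⊥) {x : X} {c : ℝ} (hc : Φ x = c) (ε : ℝ) :
    Convex ℝ (epsSubdifferential B Φ ε x) := by
  intro y hy z hz a b ha hb hab
  rw [mem_epsSubdifferential_iff hbot hc] at *
  refine ⟨hy.1, fun p hp => ?_⟩
  have h1 := mul_le_mul_of_nonneg_left (hy.2 p hp) ha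
  have h2 := mul_le_mul_of_nonneg_left (hz.2 p hp) hb
  rw [map_add, map_smul, map_smul, smul_eq_mul, smul_eq_mul]
  calc _ ≤ a * (p.2 - c + ε) + b * (p.2 - c + ε) := add_le_add h1 h2
    _ = _ := by rw [← add_mul, hab, one_mul]

/-- An `ε`-subgradient is nonpositive on the asymptotic cone of the sublevel set at the point. -/
theorem apply_nonpos_of_mem_asymptoticConeOf {B : X →ₗ[ℝ] Y →ₗ[ℝ] ℝ} {Φ : X → EReal}
    (hbot : ∀ u, Φ u ≠ ⊥) {x : X} {c : ℝ} (hc : Φ x = c) {ε : ℝ} {y : Y}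
    (hy : y ∈ epsSubdifferential B Φ ε x) {v : X}
    (hv : v ∈ asymptoticConeOf (sublevelSet Φ (Φ x))) : B v y ≤ 0 := by
  rw [mem_epsSubdifferential_iff hbot hc] at hy
  by_contra! hpos
  -- This step length gives the functional the value `ε + 1`, while the subgradient bound at height
  -- `c` is only `ε`.
  have ht : 0 ≤ (ε + 1) / B v y := div_nonneg (by linarith [hy.1]) hpos.le
  have hmem : Φ (x + ((ε + 1) / B v y) • v) ≤ (c : EReal) := hc ▸ hv x (le_refl (Φ x)) _ ht
  have := hy.2 (x + ((ε + 1) / B v y) • v, c) hmem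
  simp only [add_sub_cancel_left, map_smul, LinearMap.smul_apply, smul_eq_mul] at this
  rw [div_mul_cancel₀ _ hpos.ne'] at this
  linarith

/-- The convex cone generated by the epigraph of `Φ` seen from the point `(x, lam)`. -/
def epigraphCone (Φ : X → EReal) (x : X) (lam : ℝ) : Set (X × ℝ) :=
  {p | ∃ τ : ℝ, 0 < τ ∧ (x, lam) + τ • p ∈ realEpigraph Φ}

theorem smul_mem_epigraphCone {Φ : X → EReal} {x : X} {lam : ℝ} {p : X × ℝ}
    (hp : p ∈ epigraphCone Φ x lam) {t : ℝ} (ht : 0 < t) : t • p ∈ epigraphCone Φ x lam := by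
  obtain ⟨τ, hτ, h⟩ := hp
  refine ⟨τ / t, div_pos hτ ht, ?_⟩
  rwa [smul_smul, div_mul_cancel₀ _ ht.ne']

theorem sub_mem_epigraphCone {Φ : X → EReal} {x : X} {lam : ℝ} {p : X × ℝ}
    (hp : p ∈ realEpigraph Φ) : p - (x, lam) ∈ epigraphCone Φ x lam :=
  ⟨1, one_pos, by simpa using hp⟩

theorem convex_epigraphCone {Φ : X → EReal} (hΦ : Convex ℝ (realEpigraph Φ)) (x : X) (lam : ℝ) :
    Convex ℝ (epigraphCone Φ x lam) := by
  have heq : epigraphCone Φ x lam =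
      (ConvexCone.hull ℝ ((fun p => (x, lam) + p) ⁻¹' realEpigraph Φ) : Set (X × ℝ)) := by
    ext p
    rw [SetLike.mem_coe, ConvexCone.mem_hull_of_convex (hΦ.translate_preimage_right (x, lam))]
    constructor
    · rintro ⟨τ, hτ, h⟩
      exact ⟨τ⁻¹, inv_pos.2 hτ, τ • p, h, inv_smul_smul₀ hτ.ne' p⟩
    · rintro ⟨t, ht, q, hq, rfl⟩
      refine ⟨t⁻¹, inv_pos.2 ht, ?_⟩
      simpa [inv_smul_smul₀ ht.ne'] using hq
  rw [heq]
  exact ConvexCone.convex _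

end EpigraphAndSubdifferential

theorem Convex.Ici_smul {E : Type*} [AddCommGroup E] [Module ℝ E] {A : Set E}
    (hA : Convex ℝ A) : Convex ℝ (Set.Ici (0 : ℝ) • A) := by
  rintro _ ⟨s, hs, y, hy, rfl⟩ _ ⟨t, ht, z, hz, rfl⟩ a b ha hb -
  simp only [Set.mem_Ici] at hs ht
  have has := mul_nonneg ha hs
  have hbt := mul_nonneg hb ht
  -- The weights can be normalised to a convex combination in `A` only if their sum is nonzero;
  -- otherwise both products vanish and the point is `0`.
  rcases (add_nonneg has hbt).eq_or_lt with h0 | h0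
  · have h1 : a * s = 0 := by linarith
    have h2 : b * t = 0 := by linarith
    refine ⟨0, Set.self_mem_Ici, y, hy, ?_⟩
    simp [smul_smul, h1, h2]
  · refine ⟨a * s + b * t, h0.le, _, hA hy hz (div_nonneg has h0.le) (div_nonneg hbt h0.le)
      (by rw [← add_div, div_self h0.ne']), ?_⟩
    simp only [smul_add, smul_smul, mul_div_cancel₀ _ h0.ne']

/-- A point outside the closure of a cone is strictly separated from it by a functional that is
nonpositive on the cone. -/
theorem exists_clm_nonpos_pos_of_notMem_closure {E : Type*} [AddCommGroup E] [Module ℝ E]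
    [TopologicalSpace E] [IsTopologicalAddGroup E] [ContinuousSMul ℝ E] [LocallyConvexSpace ℝ E]
    {K : Set E} (hconv : Convex ℝ K) (hne : K.Nonempty)
    (hcone : ∀ k ∈ K, ∀ t : ℝ, 0 < t → t • k ∈ K) {x : E} (hx : x ∉ closure K) :
    ∃ f : StrongDual ℝ E, (∀ k ∈ K, f k ≤ 0) ∧ 0 < f x := by
  obtain ⟨f, u, hfu, hux⟩ :=
    geometric_hahn_banach_closed_point hconv.closure isClosed_closure hx
  have hlt : ∀ k ∈ K, ∀ t : ℝ, 0 < t → t * f k < u := fun k hk t ht => by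
    simpa using hfu _ (subset_closure (hcone k hk t ht))
  obtain ⟨k₀, hk₀⟩ := hne
  have hu : 0 ≤ u := by
    by_contra! hneg
    have h1 := hlt k₀ hk₀ 1 one_pos
    have hk : f k₀ < 0 := by linarith
    have h2 := hlt k₀ hk₀ (u / f k₀) (div_pos_of_neg_of_neg hneg hk)
    rw [div_mul_cancel₀ _ hk.ne] at h2
    exact lt_irrefl _ h2
  refine ⟨f, fun k hk => ?_, hu.trans_lt hux⟩
  by_contra! hpos
  have h := hlt k hk ((u + 1) / f k) (by positivity)
  rw [div_mul_cancel₀ _ hpos.ne'] at h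
  linarith

/-! ### Separation and the epigraph cone in a dual pair -/

section DualPair

variable {X Y : Type*}
  [AddCommGroup X] [Module ℝ X] [TopologicalSpace X]
  [AddCommGroup Y] [Module ℝ Y] [TopologicalSpace Y]

theorem IsGammaZero.isClosed_realEpigraph {Φ : X → EReal} (hΦ : IsGammaZero Φ) :
    IsClosed (realEpigraph Φ) :=
  hΦ.lsc.isClosed_epigraph.preimage
    (continuous_fst.prodMk (continuous_coe_real_ereal.comp continuous_snd))

theorem IsCompatibleDualPair.exists_repr_prod {B : X →ₗ[ℝ] Y →ₗ[ℝ] ℝ}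
    (hB : IsCompatibleDualPair B) (f : StrongDual ℝ (X × ℝ)) :
    ∃ (y : Y) (β : ℝ), ∀ p : X × ℝ, f p = B p.1 y - β * p.2 := by
  obtain ⟨y, hy⟩ := (hB.continuous_iff_left
    (f.comp (ContinuousLinearMap.inl ℝ X ℝ)).toLinearMap).1
    (f.comp (ContinuousLinearMap.inl ℝ X ℝ)).continuous
  refine ⟨y, -f (0, 1), fun p => ?_⟩
  have hp : p = (p.1, (0 : ℝ)) + p.2 • ((0 : X), (1 : ℝ)) := by ext <;> simp
  have hy' : f (p.1, (0 : ℝ)) = B p.1 y := by simpa using hy p.1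
  conv_lhs => rw [hp]
  rw [map_add, map_smul, hy', smul_eq_mul]
  ring

theorem IsCompatibleDualPair.isClosed_normalCone {B : X →ₗ[ℝ] Y →ₗ[ℝ] ℝ}
    (hB : IsCompatibleDualPair B) (S : Set X) (x : X) : IsClosed (normalCone B S x) := by
  have h : normalCone B S x = ⋂ z ∈ S, {y | B (z - x) y ≤ 0} := by
    ext y
    simp [normalCone]
  rw [h]
  exact isClosed_biInter fun z _ => isClosed_le
    ((hB.continuous_iff_right (B (z - x))).2 ⟨z - x, fun _ => rfl⟩) continuous_const

variable [IsTopologicalAddGroup X] [ContinuousSMul ℝ X]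

/-- A horizontal direction in the closed cone generated by the epigraph seen from a point strictly
below the graph either leads into the sublevel set or is asymptotic. -/
theorem IsGammaZero.exists_le_or_mem_asymptoticConeOf {Φ : X → EReal} (hΦ : IsGammaZero Φ)
    {x v : X} {lam c : ℝ} (hc : Φ x = c) (hlam : lam < c)
    (hv : (v, (0 : ℝ)) ∈ closure (epigraphCone Φ x lam)) :
    (∃ t : ℝ, 0 < t ∧ Φ (x + t • v) ≤ lam) ∨ v ∈ asymptoticConeOf (sublevelSet Φ (Φ x)) := by
  obtain ⟨G, hKG, hG⟩ := mem_closure_iff_ultrafilter.1 hv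
  have hG' : Filter.Tendsto id (G : Filter (X × ℝ)) (𝓝 (v, (0 : ℝ))) := hG
  have hclosed := hΦ.isClosed_realEpigraph
  have hex : ∀ p : X × ℝ, ∃ τ : ℝ, p ∈ epigraphCone Φ x lam →
      0 < τ ∧ (x, lam) + τ • p ∈ realEpigraph Φ := by
    intro p
    by_cases hp : p ∈ epigraphCone Φ x lam
    · exact hp.imp fun τ h _ => h
    · exact ⟨0, fun h => absurd h hp⟩
  choose τ hτ using hex
  -- The stretch factors `τ p` along the ultrafilter are either bounded, and then converge to the
  -- required `t`, or tend to infinity, and then `v` is asymptotic.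
  by_cases hbdd : ∃ M : ℝ, ∀ᶠ p in (G : Filter (X × ℝ)), τ p ≤ M
  · left
    obtain ⟨M, hM⟩ := hbdd
    have hIcc : ∀ᶠ p in (G : Filter (X × ℝ)), τ p ∈ Set.Icc 0 M := by
      filter_upwards [hM, hKG] with p h1 h2 using ⟨(hτ p h2).1.le, h1⟩
    obtain ⟨t, ht, hGt⟩ := isCompact_Icc.ultrafilter_le_nhds' (G.map τ) hIcc
    have hlim : Filter.Tendsto (fun p => (x, lam) + τ p • p) (G : Filter (X × ℝ))
        (𝓝 ((x, lam) + t • (v, (0 : ℝ)))) :=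
      tendsto_const_nhds.add (Filter.Tendsto.smul (f := τ) hGt hG')
    have hmem := hclosed.mem_of_tendsto hlim
      (Filter.Eventually.mono hKG fun p hp => (hτ p hp).2)
    have hle : Φ (x + t • v) ≤ (lam : EReal) := by simpa [realEpigraph] using hmem
    refine ⟨t, ht.1.lt_of_ne' ?_, hle⟩
    rintro rfl
    rw [zero_smul, add_zero, hc] at hle
    exact absurd (EReal.coe_le_coe_iff.1 hle) hlam.not_ge
  · right
    have htop : Filter.Tendsto τ (G : Filter (X × ℝ)) Filter.atTop := by
      refine Filter.tendsto_atTop.2 fun M => ?_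
      have h := (Ultrafilter.eventually_not (f := G) (p := fun p => τ p ≤ M)).2
        fun h => hbdd ⟨M, h⟩
      exact h.mono fun p hp => (not_le.1 hp).le
    intro z hz t ht
    have hz' : (z, c) ∈ realEpigraph Φ := le_trans hz hc.le
    have hdiv : Filter.Tendsto (fun p => t / τ p) (G : Filter (X × ℝ)) (𝓝 0) :=
      htop.const_div_atTop t
    -- This is the convex combination of `(z, c)` and `(x, lam) + τ p • p` with weight `t / τ p` on
    -- the latter. Since the weight tends to `0`, the base point `(x, lam)` disappears in the limit.
    have hlim : Filter.Tendsto
        (fun p : X × ℝ => (z, c) + (t / τ p) • ((x, lam) - (z, c)) + t • p)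
        (G : Filter (X × ℝ))
        (𝓝 ((z, c) + (0 : ℝ) • ((x, lam) - (z, c)) + t • (v, (0 : ℝ)))) :=
      (tendsto_const_nhds.add (hdiv.smul_const _)).add (hG'.const_smul t)
    have hmem := hclosed.mem_of_tendsto hlim (by
      filter_upwards [hKG, htop.eventually_ge_atTop t] with p hp htp
      obtain ⟨hpos, hepi⟩ := hτ p hp
      have hle : t / τ p ≤ 1 := (div_le_one hpos).2 htp
      have hcomb := hΦ.convex hz' hepi (sub_nonneg.2 hle) (div_nonneg ht hpos.le)
        (sub_add_cancel _ _)
      change _ ∈ realEpigraph Φ at hcomb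
      convert hcomb using 1
      rw [smul_add, smul_smul, div_mul_cancel₀ _ hpos.ne', smul_sub, sub_smul, one_smul]
      abel)
    change Φ (z + t • v) ≤ Φ x
    rw [hc]
    simpa [realEpigraph] using hmem

variable [LocallyConvexSpace ℝ X]

/-- Strict separation of `(x, c - ε)` from the closed epigraph. Comparing with `(x, c)`, directly
above, gives `β * ε > 0`, so the hyperplane is not vertical and can be normalised. -/
theorem IsGammaZero.epsSubdifferential_nonempty {B : X →ₗ[ℝ] Y →ₗ[ℝ] ℝ}
    (hB : IsCompatibleDualPair B) {Φ : X → EReal} (hΦ : IsGammaZero Φ) {x : X} {c : ℝ}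
    (hc : Φ x = c) {ε : ℝ} (hε : 0 < ε) : (epsSubdifferential B Φ ε x).Nonempty := by
  have hx : (x, c - ε) ∉ realEpigraph Φ := by
    intro h
    have h' : Φ x ≤ ((c - ε : ℝ) : EReal) := h
    rw [hc, EReal.coe_le_coe_iff] at h'
    linarith
  obtain ⟨f, u, hfu, hux⟩ :=
    geometric_hahn_banach_closed_point hΦ.convex hΦ.isClosed_realEpigraph hx
  obtain ⟨y, β, hf⟩ := hB.exists_repr_prod f
  simp only [hf] at hfu hux
  have hβ : 0 < β := by
    have := hfu (x, c) hc.le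
    simp only at this
    nlinarith
  refine ⟨β⁻¹ • y, (mem_epsSubdifferential_iff hΦ.ne_bot hc).2 ⟨hε.le, fun p hp => ?_⟩⟩
  rw [map_smul, smul_eq_mul, inv_mul_le_iff₀ hβ, map_sub, LinearMap.sub_apply]
  linarith [hfu p hp]

/-- A direction outside the closed cone generated by the epigraph seen from `(x, c - ε)` is
detected by an `ε`-subgradient at `x`. -/
theorem IsGammaZero.exists_mem_epsSubdifferential_pos {B : X →ₗ[ℝ] Y →ₗ[ℝ] ℝ}
    (hB : IsCompatibleDualPair B) {Φ : X → EReal} (hΦ : IsGammaZero Φ) {x v : X} {lam c : ℝ}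
    (hc : Φ x = c) (hlam : lam < c)
    (hv : (v, (0 : ℝ)) ∉ closure (epigraphCone Φ x lam)) :
    ∃ y ∈ epsSubdifferential B Φ (c - lam) x, 0 < B v y := by
  have hxc : (x, c) ∈ realEpigraph Φ := hc.le
  obtain ⟨f, hfK, hfv⟩ := exists_clm_nonpos_pos_of_notMem_closure
    (convex_epigraphCone hΦ.convex x lam) ⟨_, sub_mem_epigraphCone hxc⟩
    (fun k hk t ht => smul_mem_epigraphCone hk ht) hv
  obtain ⟨y, β, hf⟩ := hB.exists_repr_prod f
  have hepi : ∀ p ∈ realEpigraph Φ, B (p.1 - x) y ≤ β * (p.2 - lam) := fun p hp => by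
    have := hfK _ (sub_mem_epigraphCone (x := x) (lam := lam) hp)
    simpa [hf] using this
  have hvy : 0 < B v y := by simpa [hf] using hfv
  have hβ : 0 ≤ β := by
    have := hepi _ hxc
    simp only [sub_self, map_zero, LinearMap.zero_apply] at this
    exact nonneg_of_mul_nonneg_left this (sub_pos.2 hlam)
  simp only [mem_epsSubdifferential_iff hΦ.ne_bot hc]
  -- If `β = 0` the hyperplane is vertical, and `y` is nonpositive on `p.1 - x` over the epigraph.
  -- Adding a nonnegative multiple of `y` to a subgradient `z` keeps it a subgradient; the multiple
  -- is chosen to bring the value at `v` to `B v z + |B v z| + 1`.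
  rcases hβ.eq_or_lt with rfl | hβ
  · obtain ⟨z, hz⟩ := hΦ.epsSubdifferential_nonempty hB hc (sub_pos.2 hlam)
    rw [mem_epsSubdifferential_iff hΦ.ne_bot hc] at hz
    have hs : 0 ≤ (|B v z| + 1) / B v y := by positivity
    refine ⟨z + ((|B v z| + 1) / B v y) • y, ⟨hz.1, fun p hp => ?_⟩, ?_⟩
    · rw [map_add, map_smul, smul_eq_mul]
      have h1 := hepi p hp
      rw [zero_mul] at h1
      linarith [hz.2 p hp, mul_nonpos_of_nonneg_of_nonpos hs h1]
    · rw [map_add, map_smul, smul_eq_mul, div_mul_cancel₀ _ hvy.ne']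
      linarith [neg_abs_le (B v z)]
  · refine ⟨β⁻¹ • y, ⟨(sub_pos.2 hlam).le, fun p hp => ?_⟩, ?_⟩
    · rw [map_smul, smul_eq_mul, inv_mul_le_iff₀ hβ]
      calc _ ≤ _ := hepi p hp
        _ = _ := by ring
    · rw [map_smul, smul_eq_mul]
      positivity

variable [IsTopologicalAddGroup Y] [ContinuousSMul ℝ Y] [LocallyConvexSpace ℝ Y]

theorem normalCone_sublevelSet_union_eq_closure {B : X →ₗ[ℝ] Y →ₗ[ℝ] ℝ}
    (hB : IsCompatibleDualPair B) {Φ : X → EReal} (hΦ : IsGammaZero Φ) {x : X} {lam c : ℝ}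
    (hc : Φ x = c) (hlam : lam < c) :
    normalCone B
        (sublevelSet Φ lam ∪ (fun v => x + v) '' asymptoticConeOf (sublevelSet Φ (Φ x))) x =
      closure (Set.Ici (0 : ℝ) • epsSubdifferential B Φ (c - lam) x) := by
  apply subset_antisymm
  · intro y hy
    by_contra hcl
    have hconv := (convex_epsSubdifferential (B := B) hΦ.ne_bot hc (c - lam)).Ici_smul
    obtain ⟨a, ha⟩ := hΦ.epsSubdifferential_nonempty hB hc (sub_pos.2 hlam)
    obtain ⟨g, hg, hgy⟩ := exists_clm_nonpos_pos_of_notMem_closure hconv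
      ⟨_, Set.smul_mem_smul Set.self_mem_Ici ha⟩ (by
        rintro _ ⟨s, hs, z, hz, rfl⟩ t ht
        exact ⟨t * s, mul_nonneg ht.le hs, z, hz, mul_smul t s z⟩) hcl
    obtain ⟨v, hv⟩ := (hB.continuous_iff_right g.toLinearMap).1 g.continuous
    replace hv : ∀ z, g z = B v z := hv
    rw [hv] at hgy
    by_cases hvK : (v, (0 : ℝ)) ∈ closure (epigraphCone Φ x lam)
    · rcases hΦ.exists_le_or_mem_asymptoticConeOf hc hlam hvK with ⟨t, ht, hle⟩ | hv'
      · have := hy _ (Or.inl hle)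
        rw [add_sub_cancel_left, map_smul, LinearMap.smul_apply, smul_eq_mul] at this
        exact absurd this (mul_pos ht hgy).not_ge
      · have := hy _ (Or.inr ⟨v, hv', rfl⟩)
        rw [add_sub_cancel_left] at this
        exact absurd this hgy.not_ge
    · obtain ⟨z, hz, hpos⟩ := hΦ.exists_mem_epsSubdifferential_pos hB hc hlam hvK
      have := hg _ (Set.smul_mem_smul (Set.mem_Ici.2 zero_le_one) hz)
      rw [one_smul, hv] at this
      exact absurd this hpos.not_ge
  · refine closure_minimal ?_ (hB.isClosed_normalCone _ _)
    rintro _ ⟨t, ht, y, hy, rfl⟩ z hz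
    rw [map_smul, smul_eq_mul]
    refine mul_nonpos_of_nonneg_of_nonpos ht ?_
    rcases hz with hz | ⟨v, hv, rfl⟩
    · have := ((mem_epsSubdifferential_iff hΦ.ne_bot hc).1 hy).2 (z, lam) hz
      linarith
    · rw [add_sub_cancel_left]
      exact apply_nonpos_of_mem_asymptoticConeOf hΦ.ne_bot hc hy hv

end DualPair

/-! ### The two statements on normal cones -/

theorem corollary3p5 {X Y : Type*}
    [AddCommGroup X] [Module ℝ X] [TopologicalSpace X] [IsTopologicalAddGroup X]
    [ContinuousSMul ℝ X] [LocallyConvexSpace ℝ X]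
    [AddCommGroup Y] [Module ℝ Y] [TopologicalSpace Y] [IsTopologicalAddGroup Y]
    [ContinuousSMul ℝ Y] [LocallyConvexSpace ℝ Y]
    (B : X →ₗ[ℝ] Y →ₗ[ℝ] ℝ) (hB : IsCompatibleDualPair B)
    (Φ : X → EReal) (hΦ : IsGammaZero Φ)
    (xbar : X) (hxbar : xbar ∈ effectiveDomain Φ) (lam : ℝ) :
    ((sublevelSet Φ lam).Nonempty → (lam : EReal) < Φ xbar →
      normalCone B
          (sublevelSet Φ lam ∪
            (fun v => xbar + v) '' asymptoticConeOf (sublevelSet Φ (Φ xbar))) xbar =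
        closure (Set.Ici (0 : ℝ) • epsSubdifferential B Φ ((Φ xbar).toReal - lam) xbar)) ∧
    (sublevelSet Φ lam = ∅ →
      normalCone B
          ((fun v => xbar + v) '' asymptoticConeOf (sublevelSet Φ (Φ xbar))) xbar =
        kuratowskiLimsup
          (Filter.comap (fun p : ℝ × ℝ => p.1 * (lam - (Φ xbar).toReal + p.2)) (𝓝 0) ⊓
            Filter.principal {p : ℝ × ℝ | 0 ≤ p.1})
          (fun p : ℝ × ℝ => p.1 • epsSubdifferential B Φ p.2 xbar) ∧
      ∀ ε : ℝ, (Φ xbar).toReal - lam ≤ ε →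
        normalCone B
            ((fun v => xbar + v) '' asymptoticConeOf (sublevelSet Φ (Φ xbar))) xbar =
          closure (Set.Ici (0 : ℝ) • epsSubdifferential B Φ ε xbar)) := by
  
  obtain ⟨c, hc⟩ : ∃ c : ℝ, Φ xbar = c :=
    ⟨_, (EReal.coe_toReal (ne_of_lt hxbar) (hΦ.ne_bot xbar)).symm⟩
  have htoReal : (Φ xbar).toReal = c := by rw [hc, EReal.toReal_coe]
  rw [htoReal]
  constructor
  · intro _ hlam
    rw [hc, EReal.coe_lt_coe_iff] at hlam
    exact normalCone_sublevelSet_union_eq_closure hB hΦ hc hlam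
  intro hempty
  have hlow : ∀ u, (lam : EReal) < Φ u := fun u => by
    by_contra! hu
    exact hempty.le (show u ∈ sublevelSet Φ lam from hu)
  have hlam : lam < c := by
    have := hlow xbar
    rwa [hc, EReal.coe_lt_coe_iff] at this
  have hclosure : ∀ ε : ℝ, c - lam ≤ ε →
      normalCone B ((fun v => xbar + v) '' asymptoticConeOf (sublevelSet Φ (Φ xbar))) xbar =
        closure (Set.Ici (0 : ℝ) • epsSubdifferential B Φ ε xbar) := by
    intro ε hε
    -- The level `c - ε` is at most `lam`, so its sublevel set is empty too and only the asymptotic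
    -- part of the union remains.
    have h := normalCone_sublevelSet_union_eq_closure hB hΦ hc
      (show c - ε < c by linarith)
    have hempty' : sublevelSet Φ ((c - ε : ℝ) : EReal) = ∅ := by
      refine Set.eq_empty_of_forall_notMem fun u hu => ?_
      have hle : ((c - ε : ℝ) : EReal) ≤ lam := EReal.coe_le_coe_iff.2 (by linarith)
      exact absurd (le_trans hu hle) (hlow u).not_ge
    rwa [hempty', Set.empty_union, sub_sub_cancel] at h
  refine ⟨subset_antisymm ?_ ?_, hclosure⟩
  · rw [hclosure _ le_rfl]
    intro ξ hξ W hW Z hZ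
    obtain ⟨_, hmW, μ, hμ, y, hy, rfl⟩ := mem_closure_iff_nhds.1 hξ W hW
    -- With `ε = c - lam` the product `μ * (lam - c + ε)` is exactly `0`, hence in every
    -- neighbourhood of `0`.
    refine ⟨(μ, c - lam), ?_, _, Set.smul_mem_smul_set hy, hmW⟩
    obtain ⟨U, hU, V, hV, rfl⟩ := Filter.mem_inf_iff.1 hZ
    obtain ⟨T, hT, hTU⟩ := Filter.mem_comap.1 hU
    refine ⟨hTU ?_, Filter.mem_principal.1 hV hμ⟩
    simpa using mem_of_mem_nhds hT
  · intro ξ hξ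
    rw [← (hB.isClosed_normalCone _ _).closure_eq]
    refine mem_closure_iff_nhds.2 fun W hW => ?_
    -- Only `μ ≥ 0` matters here: `ε`-subgradients are nonpositive on the asymptotic cone whatever
    -- `ε` is.
    obtain ⟨⟨μ, ε⟩, hμ, _, ⟨y, hy, rfl⟩, hmW⟩ :=
      hξ W hW {p : ℝ × ℝ | 0 ≤ p.1} (Filter.mem_inf_of_right (Filter.mem_principal_self _))
    refine ⟨_, hmW, ?_⟩
    rintro _ ⟨v, hv, rfl⟩
    simp only [add_sub_cancel_left, map_smul, smul_eq_mul]
    exact mul_nonpos_of_nonneg_of_nonpos hμ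
      (apply_nonpos_of_mem_asymptoticConeOf hΦ.ne_bot hc hy hv)
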